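/- Let $G$ be a finite acyclic directed graph, and order its vertices by $G$-order: $a\ge b$ if there is a directed path from $a$ to $b$. An independent set is a set of pairwise non-adjacent vertices. A pair $(\mathcal D,\mathcal U)$ of disjoint independent sets is orthogonal if there is no edge from an element of $\mathcal D$ to an element of $\mathcal U$. It is tight if it is no longer an orthogonal pair of independent sets whenever (a) a new element is added to $\mathcal D$ or to $\mathcal U$, or (b) one or several elements of $\mathcal D$ are removed and replaced by one element not in $\mathcal D$ that is larger than each of them, or (c) one or several elements of $\mathcal U$ are removed and replaced by one element not in $\mathcal U$ that is smaller than each of them. Let $\mathrm{top}(G)$ be the set of tight orthogonal pairs. Fix any linear order $\ell$ of the vertices in which $b$ precedes $a$ for every edge $a\to b$, and any linear order $\ell'$ in which $a$ precedes $b$ for every edge $a\to b$. For $(\mathcal D,\mathcal U)\in\mathrm{top}(G)$ and $g\in\mathcal U$, the upward flip at $g$ is obtained as follows. Put $\mathcal D'=\{k\in\mathcal D: k\not\le g\}\cup\{g\}$ and $\mathcal U'=\{k\in\mathcal U: k\not\ge g\}$. Run once through the vertices $k\not\ge g$ in the order $\ell'$, adding $k$ to $\mathcal D'$ whenever $k\notin\mathcal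 U'$, there is no edge from $k$ to $\mathcal U'$, and there is no edge from the current $\mathcal D'$ to $k$. Then run once through the vertices $k\not\le g$ in the order $\ell$, adding $k$ to $\mathcal U'$ whenever $k\notin\mathcal D'$, there is no edge from $\mathcal D'$ to $k$, and there is no edge from $k$ to the current $\mathcal U'$. The result is $(\mathcal D',\mathcal U')$. The independence poset is $\mathrm{top}(G)$ ordered by the reflexive and transitive closure of the upward flips. Theorem. If the independence poset $\mathrm{top}(G)$ is a lattice, then it is a trim lattice, that is, it is 1. extremal: the length $r$ of its longest chain $x_0<x_1<\cdots<x_r$ equals the number of its join-irreducible elements and the number of its meet-irreducible elements; and 2. left modular: it has a maximal chain of elements $x$ each satisfying $(y\vee x)\wedge z=y\vee(x\wedge z)$ for all $y\le z$. -/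

import Mathlib

namespace IndependencePosets

/-! ### Directed graphs, independent sets, tight orthogonal pairs -/

/-- A directed graph is acyclic if it has no directed cycle (in particular no loop). -/
def IsAcyclic {V : Type*} (G : Digraph V) : Prop :=
  ∀ v, ¬ Relation.TransGen G.Adj v v

/-- `a ≤ b` in `G`-order: there is a directed path (possibly of length zero) from `b` to `a`. -/
def GLE {V : Type*} (G : Digraph V) (a b : V) : Prop :=
  Relation.ReflTransGen G.Adj b a

/-- `a < b` in `G`-order. -/
def GLT {V : Type*} (G : Digraph V) (a b : V) : Prop :=
  GLE G a b ∧ a ≠ b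

/-- A set of pairwise non-adjacent vertices. -/
def IsIndep {V : Type*} (G : Digraph V) (A : Finset V) : Prop :=
  ∀ a ∈ A, ∀ b ∈ A, ¬ G.Adj a b

/-- An orthogonal pair of independent sets: `D` and `U` are disjoint and independent, and there is
no edge from an element of `D` to an element of `U`. -/
def IsOrthogonal {V : Type*} (G : Digraph V) (D U : Finset V) : Prop :=
  IsIndep G D ∧ IsIndep G U ∧ Disjoint D U ∧ ∀ d ∈ D, ∀ u ∈ U, ¬ G.Adj d u

/-- A tight orthogonal pair. The set `S` of replaced elements may be empty (then the element `g` is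
added), a singleton (then one element is increased, resp. decreased, to `g`), or larger
(then several elements are increased, resp. decreased, to the same element `g`). -/
structure IsTight {V : Type*} [DecidableEq V] (G : Digraph V) (D U : Finset V) : Prop where
  orthogonal : IsOrthogonal G D U
  tight_left : ∀ g, g ∉ D → ∀ S : Finset V, S ⊆ D → (∀ s ∈ S, GLT G s g) →
    ¬ IsOrthogonal G (insert g (D \ S)) U
  tight_right : ∀ g, g ∉ U → ∀ S : Finset V, S ⊆ U → (∀ s ∈ S, GLT G g s) →
    ¬ IsOrthogonal G D (insert g (U \ S))

/-- The set of all tight orthogonal pairs ("tops") of `G`. -/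
@[ext]
structure Top {V : Type*} [DecidableEq V] (G : Digraph V) where
  D : Finset V
  U : Finset V
  tight : IsTight G D U

/-! ### Flips -/

/-- A linear extension of `G`-order, as an enumeration of the vertices in which `b` precedes `a`
whenever there is an edge from `a` to `b`. -/
structure LinearExt {V : Type*} [DecidableEq V] (G : Digraph V) where
  toList : List V
  nodup : toList.Nodup
  complete : ∀ v, v ∈ toList
  precedes : ∀ a b, G.Adj a b → toList.idxOf b < toList.idxOf a

/-- A reverse linear extension of `G`-order, as an enumeration of the vertices in which `a` precedes
`b` whenever there is an edge from `a` to `b`. -/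
structure RevLinearExt {V : Type*} [DecidableEq V] (G : Digraph V) where
  toList : List V
  nodup : toList.Nodup
  complete : ∀ v, v ∈ toList
  precedes : ∀ a b, G.Adj a b → toList.idxOf a < toList.idxOf b

open Classical in
/-- One pass through the list `l`, starting from `D`: a vertex `k` with `k ≱ g` is added whenever it
is not in `U`, has no edge to `U`, and has no edge from the set built so far. -/
noncomputable def fillD {V : Type*} [DecidableEq V] (G : Digraph V) (g : V) (l : List V)
    (D U : Finset V) : Finset V :=
  l.foldl (fun S k =>
    if ¬ GLE G g k ∧ k ∉ U ∧ (∀ i ∈ U, ¬ G.Adj k i) ∧ (∀ i ∈ S, ¬ G.Adj i k)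
    then insert k S else S) D

open Classical in
/-- One pass through the list `l`, starting from `U`: a vertex `k` with `k ≰ g` is added whenever it
is not in `D`, has no edge from `D`, and has no edge to the set built so far. -/
noncomputable def fillU {V : Type*} [DecidableEq V] (G : Digraph V) (g : V) (l : List V)
    (D U : Finset V) : Finset V :=
  l.foldl (fun S k =>
    if ¬ GLE G k g ∧ k ∉ D ∧ (∀ i ∈ D, ¬ G.Adj i k) ∧ (∀ i ∈ S, ¬ G.Adj k i)
    then insert k S else S) U

/-- Complete `(D, U)` greedily: first `D` along `ℓ'`, then `U` along `ℓ`. -/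
noncomputable def complete {V : Type*} [DecidableEq V] (G : Digraph V) (ℓ : LinearExt G)
    (ℓ' : RevLinearExt G) (g : V) (D U : Finset V) : Finset V × Finset V :=
  (fillD G g ℓ'.toList D U, fillU G g ℓ.toList (fillD G g ℓ'.toList D U) U)

open Classical in
/-- The flip of `(D, U)` at `g`: do nothing if `g ∉ D ∪ U`; otherwise keep the elements of `D` that
are not less than `g` and the elements of `U` that are not greater than `g`, switch the set to
which `g` belongs, and complete greedily. -/
noncomputable def flip {V : Type*} [DecidableEq V] (G : Digraph V) (ℓ : LinearExt G)
    (ℓ' : RevLinearExt G) (g : V) (D U : Finset V) : Finset V × Finset V :=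
  if g ∈ U then
    complete G ℓ ℓ' g (insert g (D.filter fun k => ¬ GLE G k g)) (U.filter fun k => ¬ GLE G g k)
  else if g ∈ D then
    complete G ℓ ℓ' g (D.filter fun k => ¬ GLE G k g) (insert g (U.filter fun k => ¬ GLE G g k))
  else (D, U)

/-! ### The independence poset -/

/-- `y` is obtained from `x` by an upward flip, that is, a flip at some `g ∈ x.U`. -/
def FlipUp {V : Type*} [DecidableEq V] {G : Digraph V} (ℓ : LinearExt G) (ℓ' : RevLinearExt G)
    (x y : Top G) : Prop :=
  ∃ g ∈ x.U, flip G ℓ ℓ' g x.D x.U = (y.D, y.U)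

theorem subset_fillD {V : Type*} [DecidableEq V] (G : Digraph V) (g : V) (l : List V)
    (D U : Finset V) : D ⊆ fillD G g l D U := by
  unfold fillD
  induction l generalizing D with
  | nil => simp
  | cons k l ih =>
    rw [List.foldl_cons]
    refine Finset.Subset.trans ?_ (ih _)
    split_ifs
    · exact Finset.subset_insert _ _
    · exact Finset.Subset.refl _

theorem LinearExt.idxOf_le {V : Type*} [DecidableEq V] {G : Digraph V} (ℓ : LinearExt G) {a b : V}
    (h : GLE G a b) : ℓ.toList.idxOf a ≤ ℓ.toList.idxOf b := by
  induction h with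
  | refl => exact le_refl _
  | tail _ h ih => exact (ℓ.precedes _ _ h).le.trans ih

theorem LinearExt.idxOf_injective {V : Type*} [DecidableEq V] {G : Digraph V} (ℓ : LinearExt G) :
    Function.Injective fun a => ℓ.toList.idxOf a :=
  fun a _ h => (List.idxOf_inj (ℓ.complete a)).1 h

/-- Upward flips increase the first component in colexicographic order along `ℓ`. -/
theorem FlipUp.colex_lt {V : Type*} [DecidableEq V] {G : Digraph V} {ℓ : LinearExt G}
    {ℓ' : RevLinearExt G} {x y : Top G} (h : FlipUp ℓ ℓ' x y) :
    toColex (x.D.image fun a => ℓ.toList.idxOf a) <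
      toColex (y.D.image fun a => ℓ.toList.idxOf a) := by
  classical
  obtain ⟨g, hg, h⟩ := h
  have hD : insert g (x.D.filter fun k => ¬ GLE G k g) ⊆ y.D := by
    have h1 := congrArg Prod.fst h
    simp only [flip, if_pos hg, complete] at h1
    rw [← h1]
    convert subset_fillD _ _ _ _ _
  have hgD : g ∉ x.D := fun hx => Finset.disjoint_left.1 x.tight.orthogonal.2.2.1 hx hg
  rw [Finset.Colex.toColex_lt_toColex_iff_exists_forall_lt]
  refine ⟨_, Finset.mem_image_of_mem _ (hD (Finset.mem_insert_self _ _)), ?_, ?_⟩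
  · rw [Finset.mem_image]
    rintro ⟨a, ha, hag⟩
    exact hgD (ℓ.idxOf_injective hag ▸ ha)
  · intro i hi hi2
    obtain ⟨b, hb, rfl⟩ := Finset.mem_image.1 hi
    have hby : b ∉ y.D := fun hy => hi2 (Finset.mem_image_of_mem _ hy)
    have hle : GLE G b g := by
      by_contra hn
      exact hby (hD (Finset.mem_insert_of_mem (Finset.mem_filter.2 ⟨hb, hn⟩)))
    refine lt_of_le_of_ne (ℓ.idxOf_le hle) fun he => hgD ?_
    exact ℓ.idxOf_injective he ▸ hb

/-- The set `top(G)`, to be ordered by means of flips computed along `ℓ` and `ℓ'`. -/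
def IndepPoset {V : Type*} [DecidableEq V] (G : Digraph V) (_ℓ : LinearExt G)
    (_ℓ' : RevLinearExt G) : Type _ :=
  Top G

/-- The independence poset: the reflexive and transitive closure of the upward flips. -/
instance instPartialOrderIndepPoset {V : Type*} [DecidableEq V] (G : Digraph V) (ℓ : LinearExt G)
    (ℓ' : RevLinearExt G) : PartialOrder (IndepPoset G ℓ ℓ') where
  le x y := Relation.ReflTransGen (FlipUp ℓ ℓ') x y
  le_refl _ := Relation.ReflTransGen.refl
  le_trans _ _ _ h1 h2 := Relation.ReflTransGen.trans h1 h2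
  le_antisymm x y h1 h2 := by
    have key : ∀ {u v : Top G}, Relation.TransGen (FlipUp ℓ ℓ') u v →
        toColex (u.D.image fun a => ℓ.toList.idxOf a) <
          toColex (v.D.image fun a => ℓ.toList.idxOf a) := by
      intro u v h
      induction h with
      | single h => exact h.colex_lt
      | tail _ h ih => exact ih.trans h.colex_lt
    rcases Relation.reflTransGen_iff_eq_or_transGen.1 h1 with h | h
    · exact h.symm
    · exact absurd (key (h.trans_left h2)) (lt_irrefl _)

/-! ### Trim lattices -/

/-- An extremal lattice: the longest chain has length equal to the number of join-irreducible
elements and to the number of meet-irreducible elements (a chain `x₀ < ⋯ < xᵣ` has length `r`). -/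
def IsExtremalLattice (L : Type*) [Lattice L] : Prop :=
  ∃ n : ℕ, IsGreatest {r : ℕ | ∃ s : LTSeries L, s.length = r} n ∧
    {x : L | SupIrred x}.encard = n ∧ {x : L | InfIrred x}.encard = n

/-- A left modular element of a lattice. -/
def IsLeftModular {L : Type*} [Lattice L] (x : L) : Prop :=
  ∀ y z : L, y ≤ z → (y ⊔ x) ⊓ z = y ⊔ (x ⊓ z)

/-- A left modular lattice: there is a maximal chain of left modular elements. -/
def IsLeftModularLattice (L : Type*) [Lattice L] : Prop :=
  ∃ C : Set L, IsMaxChain (· ≤ ·) C ∧ ∀ x ∈ C, IsLeftModular x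

/-- The poset `P` is a lattice: any two elements have a least upper bound and a greatest lower
bound. -/
def IsLatticePoset (P : Type*) [PartialOrder P] : Prop :=
  ∀ x y : P, (∃ z, IsLUB {x, y} z) ∧ (∃ z, IsGLB {x, y} z)

/-- The poset `P` is a trim lattice: its order is that of an extremal left modular lattice. -/
def IsTrimLatticePoset (P : Type*) [inst : PartialOrder P] : Prop :=
  ∃ L : Lattice P, L.toPartialOrder = inst ∧ @IsExtremalLattice P L ∧ @IsLeftModularLattice P L

end IndependencePosets

namespace IndependencePosets

/-! Fix a linear extension. Tightness is local: `k ∈ D ∪ U` exactly when no edge from `D` reaches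
`k` and no edge from `k` reaches `U`. Hence, for any cut rank `h`, a top is determined by `D` at
ranks at least `h` and `U` below `h`, and any compatible choice of the two occurs
(`LinearExt.top_ext`, `LinearExt.exists_top`). In these coordinates an upward flip at `g` moves `g`
from `U` to `D` and keeps `D` after `g` and `U` before `g` (`flipUp_iff`).

Let `j g` be the top with `D = {g}` and `m g` the top with `U = {g}`. Then `g ∈ x.D` gives `j g ≤
x`, and `g ∈ x.U` gives `x ≤ m g`. Every cover is a flip at some `g`, so once `j g ≰ m g` is known,
`j g` and `m g` separate its two ends. This non-inequality is the only use of the lattice hypothesis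
(`IndepPoset.not_le_of_D_eq_of_U_eq`).

The tops `s i`, with `D` confined to ranks below `i` and `U` to ranks at least `i`, form a chain of
length `|V|`. It flips the vertices one at a time, so each `s i` is above `j g` or below `m g`. Such
a labelling and chain force extremality by counting, and left modularity of the chain because the
label of a cover violating it would contradict this dichotomy (`isTrim_of_labelling`). -/

/-! ### Trimness from a labelling of covers -/

open Classical in
theorem strictMono_card_le {L V : Type*} [Lattice L] [Finite L] [Fintype V] {j : V → L}
    (hj : ∀ x y : L, x ⋖ y → ∃ g, j g ≤ y ∧ ¬ j g ≤ x) :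
    StrictMono fun x : L => (Finset.univ.filter fun g => j g ≤ x).card := by
  intro x y hxy
  refine Finset.card_lt_card (Finset.ssubset_iff_of_subset ?_ |>.2 ?_)
  · intro g hg
    simp only [Finset.mem_filter, Finset.mem_univ, true_and] at hg ⊢
    exact hg.trans hxy.le
  -- The label of the first cover on the way from `x` to `y` is newly collected.
  · obtain ⟨w, hxw, hwy⟩ := exists_covBy_le_of_lt hxy
    obtain ⟨g, h1, h2⟩ := hj x w hxw
    exact ⟨g, by simpa using h1.trans hwy, by simpa using h2⟩

theorem length_le_card {L V : Type*} [Lattice L] [Finite L] [Fintype V] {j : V → L}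
    (hj : ∀ x y : L, x ⋖ y → ∃ g, j g ≤ y ∧ ¬ j g ≤ x) (s : LTSeries L) :
    s.length ≤ Fintype.card V := by
  classical
  have h := (s.map _ (strictMono_card_le hj)).head_add_length_le_nat
  have h2 : (s.map _ (strictMono_card_le hj)).last ≤ Fintype.card V := by
    rw [LTSeries.last_map]
    exact Finset.card_le_univ _
  have h3 : (s.map _ (strictMono_card_le hj)).length = s.length := rfl
  omega

/-- For the upper bound, a join-irreducible `x` covering `w` is `w ⊔ j g` for the label `g` of that
cover, so `x = j g`. For the lower bound, an element is the join of the irreducibles below it, so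
their number grows strictly along the chain `s`. -/
theorem supIrred_encard {L V : Type*} [Lattice L] [Finite L] [Fintype V] (j : V → L)
    (hj : ∀ x y : L, x ⋖ y → ∃ g, j g ≤ y ∧ ¬ j g ≤ x) (s : LTSeries L)
    (hs : s.length = Fintype.card V) : {x : L | SupIrred x}.encard = Fintype.card V := by
  classical
  have := Fintype.ofFinite L
  apply le_antisymm
  · have hsub : {x : L | SupIrred x} ⊆ Set.range j := by
      intro x hx
      simp only [Set.mem_ofPred_eq] at hx
      obtain ⟨y, hy⟩ : ∃ y, y < x := by
        have := hx.1
        rw [isMin_iff_forall_not_lt] at this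
        push Not at this
        exact this
      obtain ⟨w, -, hwx⟩ := exists_le_covBy_of_lt hy
      obtain ⟨g, h1, h2⟩ := hj w x hwx
      refine ⟨g, ?_⟩
      have hsup : w ⊔ j g = x := by
        rcases hwx.eq_or_eq le_sup_left (sup_le hwx.le h1) with h | h
        · exact absurd (sup_eq_left.1 h) h2
        · exact h
      rcases hx.2 hsup with h | h
      · exact absurd h hwx.ne
      · exact h
    calc _ ≤ (Set.range j).encard := Set.encard_le_encard hsub
      _ ≤ (Set.univ : Set V).encard := by
        rw [← Set.image_univ]; exact Set.encard_image_le _ _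
      _ = Fintype.card V := by simp
  · have hne : Nonempty L := ⟨s.head⟩
    let _ : OrderBot L := Fintype.toOrderBot L
    have hmono : StrictMono fun x : L =>
        (Finset.univ.filter fun a : L => SupIrred a ∧ a ≤ x).card := by
      intro x y hxy
      refine Finset.card_lt_card (Finset.ssubset_iff_of_subset ?_ |>.2 ?_)
      · intro g hg
        simp only [Finset.mem_filter, Finset.mem_univ, true_and] at hg ⊢
        exact ⟨hg.1, hg.2.trans hxy.le⟩
      · by_contra! hcon
        obtain ⟨t, ht, hti⟩ := exists_supIrred_decomposition y
        refine hxy.not_ge ?_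
        rw [← ht]
        refine Finset.sup_le fun b hb => ?_
        have := hcon b (by
          simp only [Finset.mem_filter, Finset.mem_univ, true_and]
          refine ⟨hti hb, ?_⟩
          rw [← ht]
          exact Finset.le_sup (f := id) hb)
        simp only [Finset.mem_filter, Finset.mem_univ, true_and] at this
        exact this.2
    have h := (s.map _ hmono).head_add_length_le_nat
    have h3 : (s.map _ hmono).length = s.length := rfl
    have h2 : (s.map _ hmono).last ≤ (Finset.univ.filter fun a : L => SupIrred a).card := by
      simp only [LTSeries.last_map]
      exact Finset.card_le_card fun a => by simp +contextual
    have h4 : {x : L | SupIrred x}.encard = (Finset.univ.filter fun a : L => SupIrred a).card := by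
      rw [← Set.encard_coe_eq_coe_finsetCard]; simp
    rw [h4]
    exact_mod_cast (by omega)

/-- A criterion for trimness: every cover relation has a label `g`, separated by both `j g` and
`m g`, and there is a chain of maximal length all of whose elements lie above `j g` or below `m g`
for every label `g`. -/
theorem isTrim_of_labelling {L V : Type*} [Lattice L] [Finite L] [Fintype V] (j m : V → L)
    (hjm : ∀ x y : L, x ⋖ y → ∃ g, j g ≤ y ∧ ¬ j g ≤ x ∧ x ≤ m g ∧ ¬ y ≤ m g)
    (s : LTSeries L) (hs : s.length = Fintype.card V) (hsg : ∀ i g, j g ≤ s i ∨ s i ≤ m g) :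
    IsExtremalLattice L ∧ IsLeftModularLattice L := by
  classical
  have hj : ∀ x y : L, x ⋖ y → ∃ g, j g ≤ y ∧ ¬ j g ≤ x := fun x y h =>
    let ⟨g, h1, h2, _⟩ := hjm x y h
    ⟨g, h1, h2⟩
  refine ⟨⟨Fintype.card V, ⟨⟨s, hs⟩, ?_⟩, supIrred_encard j hj s hs, ?_⟩, ?_⟩
  · rintro _ ⟨t, rfl⟩
    exact length_le_card hj t
  -- In the dual lattice `m` takes over the role of `j`.
  · have h := supIrred_encard (L := Lᵒᵈ) (fun g => OrderDual.toDual (m g)) (fun x y h => by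
      obtain ⟨g, -, -, h3, h4⟩ := hjm _ _ h.ofDual
      exact ⟨g, h3, h4⟩) s.reverse hs
    exact h
  · refine ⟨Set.range s, ?_, ?_⟩
    · refine ⟨?_, ?_⟩
      · rintro _ ⟨a, rfl⟩ _ ⟨b, rfl⟩ -
        rcases le_total a b with h | h
        · exact Or.inl (s.monotone h)
        · exact Or.inr (s.monotone h)
      · intro t ht hst
        -- The number of `g` with `j g ≤ x` embeds any chain `t` into `{0, …, |V|}`, so `t` cannot
        -- have more elements than `s`.
        refine Set.eq_of_subset_of_ncard_le hst ?_
        have h1 : (Set.range s).ncard = Fintype.card V + 1 := by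
          rw [← Set.image_univ, Set.ncard_image_of_injective _ s.strictMono.injective,
            Set.ncard_univ, Nat.card_eq_fintype_card, Fintype.card_fin, hs]
        have h2 : (Set.Iic (Fintype.card V)).ncard = Fintype.card V + 1 := by
          rw [← Finset.coe_Iic, Set.ncard_coe_finset, Nat.card_Iic]
        rw [h1, ← h2]
        refine Set.ncard_le_ncard_of_injOn
          (fun x : L => (Finset.univ.filter fun g => j g ≤ x).card)
          (fun x _ => Finset.card_le_univ _) ?_ (Set.finite_Iic _)
        intro x hx y hy hxy
        by_contra hne
        rcases ht hx hy hne with h | h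
        · exact (strictMono_card_le hj (lt_of_le_of_ne h hne)).ne hxy
        · exact (strictMono_card_le hj (lt_of_le_of_ne h (Ne.symm hne))).ne hxy.symm
    · rintro _ ⟨i, rfl⟩ y z hyz
      by_contra hne
      -- Let `g` label a cover starting at the smaller side. If `j g ≤ s i`, then `j g ≤ s i ⊓ z`,
      -- which lies below that side; if `s i ≤ m g`, then `y ⊔ s i ≤ m g`, which bounds the top of
      -- the cover.
      have hlt : y ⊔ s i ⊓ z < (y ⊔ s i) ⊓ z := by
        refine lt_of_le_of_ne ?_ (Ne.symm hne)
        exact sup_le (le_inf le_sup_left hyz) (inf_le_inf_right _ le_sup_right)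
      obtain ⟨w, hw, hwz⟩ := exists_covBy_le_of_lt hlt
      obtain ⟨g, h1, h2, h3, h4⟩ := hjm _ _ hw
      rcases hsg i g with h | h
      · exact h2 (le_sup_of_le_right (le_inf h (h1.trans (hwz.trans inf_le_right))))
      · refine h4 (hwz.trans (inf_le_left.trans (sup_le (le_sup_left.trans h3) h)))

/-! ### Greedy passes as fixed points -/

/-- The test against the set built so far may be replaced by a test against the final set, since no
vertex has an `R`-arrow to an earlier entry of the list. This turns the algorithm into a recursion
that no longer mentions intermediate stages. -/
theorem mem_foldl_greedy {V : Type*} [DecidableEq V] (R : V → V → Prop) (P : V → Prop)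
    (f : Finset V → V → Finset V)
    (hf₁ : ∀ S k, (P k ∧ ∀ i ∈ S, ¬ R i k) → f S k = insert k S)
    (hf₂ : ∀ S k, ¬ (P k ∧ ∀ i ∈ S, ¬ R i k) → f S k = S)
    (hirr : ∀ a, ¬ R a a) (l : List V) (hl : l.Pairwise fun a b => ¬ R b a) (S : Finset V)
    (k : V) :
    k ∈ l.foldl f S ↔ k ∈ S ∨ (k ∈ l ∧ P k ∧ ∀ i ∈ l.foldl f S, ¬ R i k) := by
  have hsub : ∀ (l : List V) (S : Finset V), S ⊆ l.foldl f S := by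
    intro l
    induction l with
    | nil => simp
    | cons a l ih =>
      intro S
      refine Finset.Subset.trans ?_ (ih _)
      by_cases h : P a ∧ ∀ i ∈ S, ¬ R i a
      · rw [hf₁ _ _ h]; exact Finset.subset_insert _ _
      · rw [hf₂ _ _ h]
  induction l generalizing S with
  | nil => simp
  | cons a l ih =>
    rw [List.pairwise_cons] at hl
    rw [List.foldl_cons]
    have ih := ih hl.2 (f S a)
    have ha : (∀ i ∈ S, ¬ R i a) ∧ P a ↔ P a ∧ ∀ i ∈ l.foldl f (f S a), ¬ R i a := by
      refine ⟨fun h => ⟨h.2, fun i hi => ?_⟩, fun h => ⟨fun i hi => h.2 i ?_, h.1⟩⟩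
      · -- elements added later have no arrow to `a`
        have key : ∀ (l : List V) (T : Finset V), (∀ b ∈ l, ¬ R b a) → (∀ b ∈ T, ¬ R b a) →
            ∀ b ∈ l.foldl f T, ¬ R b a := by
          intro l
          induction l with
          | nil => simp
          | cons c l ih =>
            intro T hl hT
            rw [List.foldl_cons]
            refine ih _ (fun b hb => hl b (List.mem_cons_of_mem _ hb)) ?_
            by_cases hc : P c ∧ ∀ i ∈ T, ¬ R i c
            · rw [hf₁ _ _ hc]
              intro b hb
              rcases Finset.mem_insert.1 hb with rfl | hb
              · exact hl _ List.mem_cons_self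
              · exact hT b hb
            · rw [hf₂ _ _ hc]; exact hT
        refine key l _ hl.1 ?_ i hi
        rw [hf₁ S a ⟨h.2, h.1⟩]
        intro b hb
        rcases Finset.mem_insert.1 hb with rfl | hb
        · exact hirr _
        · exact h.1 b hb
      · refine hsub l _ ?_
        by_cases hc : P a ∧ ∀ i ∈ S, ¬ R i a
        · rw [hf₁ _ _ hc]; exact Finset.mem_insert_of_mem hi
        · rwa [hf₂ _ _ hc]
    refine ih.trans ?_
    rw [List.mem_cons]
    by_cases hc : P a ∧ ∀ i ∈ S, ¬ R i a
    · rw [hf₁ _ _ hc] at ha ⊢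
      have := ha.1 ⟨hc.2, hc.1⟩
      rw [Finset.mem_insert]
      constructor
      · rintro ((rfl | h) | h)
        · exact Or.inr ⟨Or.inl rfl, this⟩
        · exact Or.inl h
        · exact Or.inr ⟨Or.inr h.1, h.2⟩
      · rintro (h | ⟨rfl | h, h2⟩)
        · exact Or.inl (Or.inr h)
        · exact Or.inl (Or.inl rfl)
        · exact Or.inr ⟨h, h2⟩
    · rw [hf₂ _ _ hc] at ha ⊢
      constructor
      · rintro (h | h)
        · exact Or.inl h
        · exact Or.inr ⟨Or.inr h.1, h.2⟩
      · rintro (h | ⟨rfl | h, h2⟩)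
        · exact Or.inl h
        · exact absurd (ha.2 h2).symm hc
        · exact Or.inr ⟨h, h2⟩

theorem GLE.of_adj {V : Type*} {G : Digraph V} {a b : V} (h : G.Adj a b) : GLE G b a := Relation.ReflTransGen.single h

theorem GLE.trans {V : Type*} {G : Digraph V} {a b c : V} (h₁ : GLE G a b) (h₂ : GLE G b c) : GLE G a c :=
  Relation.ReflTransGen.trans h₂ h₁

/-! ### Ranks and uniqueness of greedy sets -/

section Rank

variable {V : Type*} [DecidableEq V] {G : Digraph V}

/-- The position of a vertex in a linear extension. -/
def LinearExt.rank (ℓ : LinearExt G) (a : V) : ℕ := ℓ.toList.idxOf a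

theorem LinearExt.rank_injective (ℓ : LinearExt G) : Function.Injective ℓ.rank :=
  ℓ.idxOf_injective

theorem LinearExt.rank_lt (ℓ : LinearExt G) {a b : V} (h : G.Adj a b) : ℓ.rank b < ℓ.rank a :=
  ℓ.precedes a b h

theorem LinearExt.rank_le (ℓ : LinearExt G) {a b : V} (h : GLE G a b) : ℓ.rank a ≤ ℓ.rank b :=
  ℓ.idxOf_le h

theorem LinearExt.not_adj_self (ℓ : LinearExt G) (a : V) : ¬ G.Adj a a := fun h =>
  lt_irrefl _ (ℓ.rank_lt h)

theorem LinearExt.length_toList [Fintype V] (ℓ : LinearExt G) :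
    ℓ.toList.length = Fintype.card V := by
  rw [← List.toFinset_card_of_nodup ℓ.nodup, ← Finset.card_univ]
  congr 1
  ext a
  simp [ℓ.complete a]

theorem LinearExt.rank_lt_card [Fintype V] (ℓ : LinearExt G) (a : V) :
    ℓ.rank a < Fintype.card V := by
  rw [← ℓ.length_toList]
  exact List.idxOf_lt_length_of_mem (ℓ.complete a)

theorem LinearExt.exists_rank_eq [Fintype V] (ℓ : LinearExt G) {i : ℕ}
    (hi : i < Fintype.card V) : ∃ g, ℓ.rank g = i := by
  rw [← ℓ.length_toList] at hi
  exact ⟨ℓ.toList[i], ℓ.nodup.idxOf_getElem i hi⟩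

theorem pairwise_of_idxOf_lt {l : List V} (hl : l.Nodup) {R : V → V → Prop}
    (h : ∀ a b, R a b → l.idxOf a < l.idxOf b) : l.Pairwise fun a b => ¬ R b a := by
  rw [List.pairwise_iff_getElem]
  intro i j hi hj hij hR
  have := h _ _ hR
  rw [hl.idxOf_getElem i hi, hl.idxOf_getElem j hj] at this
  omega

/-- The condition no longer refers to the order of the pass; with `LinearExt.greedy_left_unique`
this makes the result independent of the choice of `ℓ'`. -/
theorem mem_fillD (ℓ' : RevLinearExt G) (g : V) (D U : Finset V) (k : V) :
    k ∈ fillD G g ℓ'.toList D U ↔ k ∈ D ∨ ((¬ GLE G g k ∧ k ∉ U ∧ ∀ i ∈ U, ¬ G.Adj k i) ∧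
      ∀ i ∈ fillD G g ℓ'.toList D U, ¬ G.Adj i k) := by
  unfold fillD
  rw [mem_foldl_greedy G.Adj (fun k => ¬ GLE G g k ∧ k ∉ U ∧ ∀ i ∈ U, ¬ G.Adj k i)]
  · simp [ℓ'.complete k]
  · intro S k h
    exact if_pos ⟨h.1.1, h.1.2.1, h.1.2.2, h.2⟩
  · intro S k h
    exact if_neg fun h' => h ⟨⟨h'.1, h'.2.1, h'.2.2.1⟩, h'.2.2.2⟩
  · exact fun a h => lt_irrefl _ (ℓ'.precedes _ _ h)
  · exact pairwise_of_idxOf_lt ℓ'.nodup ℓ'.precedes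

theorem mem_fillU (ℓ : LinearExt G) (g : V) (D U : Finset V) (k : V) :
    k ∈ fillU G g ℓ.toList D U ↔ k ∈ U ∨ ((¬ GLE G k g ∧ k ∉ D ∧ ∀ i ∈ D, ¬ G.Adj i k) ∧
      ∀ i ∈ fillU G g ℓ.toList D U, ¬ G.Adj k i) := by
  unfold fillU
  rw [mem_foldl_greedy (fun a b => G.Adj b a)
    (fun k => ¬ GLE G k g ∧ k ∉ D ∧ ∀ i ∈ D, ¬ G.Adj i k)]
  · simp [ℓ.complete k]
  · intro S k h
    exact if_pos ⟨h.1.1, h.1.2.1, h.1.2.2, h.2⟩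
  · intro S k h
    exact if_neg fun h' => h ⟨⟨h'.1, h'.2.1, h'.2.2.1⟩, h'.2.2.2⟩
  · exact ℓ.not_adj_self
  · exact pairwise_of_idxOf_lt ℓ.nodup fun a b => ℓ.precedes b a

/-- A greedily built set exists for every arrow relation that decreases the rank. -/
theorem LinearExt.exists_greedy_left (ℓ : LinearExt G) (P : V → Prop) (D : Finset V) :
    ∃ F : Finset V, ∀ k, k ∈ F ↔ k ∈ D ∨ (P k ∧ ∀ i ∈ F, ¬ G.Adj i k) := by
  classical
  refine ⟨ℓ.toList.reverse.foldl
    (fun S k => if P k ∧ ∀ i ∈ S, ¬ G.Adj i k then insert k S else S) D, fun k => ?_⟩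
  have := mem_foldl_greedy G.Adj P
    (fun S k => if P k ∧ ∀ i ∈ S, ¬ G.Adj i k then insert k S else S)
    (fun S k h => if_pos h) (fun S k h => if_neg h) ℓ.not_adj_self ℓ.toList.reverse
    (by
      rw [List.pairwise_reverse]
      exact pairwise_of_idxOf_lt (R := fun a b => G.Adj b a) ℓ.nodup fun a b => ℓ.precedes b a)
    D k
  simpa [ℓ.complete k] using this

theorem LinearExt.exists_greedy_right (ℓ : LinearExt G) (P : V → Prop) (U : Finset V) :
    ∃ F : Finset V, ∀ k, k ∈ F ↔ k ∈ U ∨ (P k ∧ ∀ i ∈ F, ¬ G.Adj k i) := by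
  classical
  refine ⟨ℓ.toList.foldl
    (fun S k => if P k ∧ ∀ i ∈ S, ¬ G.Adj k i then insert k S else S) U, fun k => ?_⟩
  have := mem_foldl_greedy (fun a b => G.Adj b a) P
    (fun S k => if P k ∧ ∀ i ∈ S, ¬ G.Adj k i then insert k S else S)
    (fun S k h => if_pos h) (fun S k h => if_neg h) ℓ.not_adj_self ℓ.toList
    (pairwise_of_idxOf_lt (R := fun a b => G.Adj b a) ℓ.nodup fun a b => ℓ.precedes b a)
    U k
  simpa [ℓ.complete k] using this

/-- Two sets built by the same greedy recursion are equal. -/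
theorem LinearExt.greedy_left_unique [Fintype V] (ℓ : LinearExt G) {P : V → Prop}
    {D E F : Finset V}
    (hE : ∀ k, k ∈ E ↔ k ∈ D ∨ (P k ∧ ∀ i ∈ E, ¬ G.Adj i k))
    (hF : ∀ k, k ∈ F ↔ k ∈ D ∨ (P k ∧ ∀ i ∈ F, ¬ G.Adj i k)) : E = F := by
  -- Downward induction on rank, with `m` bounding `|V| - rank k`: whether `k` belongs depends only
  -- on sources of edges into `k`, which have larger rank.
  have key : ∀ m k, Fintype.card V ≤ ℓ.rank k + m → (k ∈ E ↔ k ∈ F) := by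
    intro m
    induction m with
    | zero => intro k hk; have := ℓ.rank_lt_card k; omega
    | succ m ih =>
      intro k hk
      rw [hE, hF]
      have : (∀ i ∈ E, ¬ G.Adj i k) ↔ ∀ i ∈ F, ¬ G.Adj i k := by
        refine forall_congr' fun i => ?_
        by_cases h : G.Adj i k
        · have := ℓ.rank_lt h
          rw [ih i (by omega)]
        · simp [h]
      rw [this]
  ext k
  exact key _ k le_add_self

theorem LinearExt.greedy_right_unique (ℓ : LinearExt G) {P : V → Prop} {U E F : Finset V}
    (hE : ∀ k, k ∈ E ↔ k ∈ U ∨ (P k ∧ ∀ i ∈ E, ¬ G.Adj k i))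
    (hF : ∀ k, k ∈ F ↔ k ∈ U ∨ (P k ∧ ∀ i ∈ F, ¬ G.Adj k i)) : E = F := by
  have key : ∀ m k, ℓ.rank k < m → (k ∈ E ↔ k ∈ F) := by
    intro m
    induction m with
    | zero => intro k hk; omega
    | succ m ih =>
      intro k hk
      rw [hE, hF]
      have : (∀ i ∈ E, ¬ G.Adj k i) ↔ ∀ i ∈ F, ¬ G.Adj k i := by
        refine forall_congr' fun i => ?_
        by_cases h : G.Adj k i
        · have := ℓ.rank_lt h
          rw [ih i (by omega)]
        · simp [h]
      rw [this]
  ext k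
  exact key _ k (Nat.lt_succ_self _)

end Rank

/-! ### Tight pairs as local data on both sides of a cut rank -/

section Tops

variable {V : Type*} [DecidableEq V] {G : Digraph V}

/-- Tightness is a local condition: the elements of `D` and `U` are exactly the vertices that
receive no edge from `D` and send no edge to `U`. -/
theorem LinearExt.isTight_iff (ℓ : LinearExt G) (D U : Finset V) :
    IsTight G D U ↔ Disjoint D U ∧
      ∀ k, (k ∈ D ∨ k ∈ U) ↔ (∀ d ∈ D, ¬ G.Adj d k) ∧ ∀ u ∈ U, ¬ G.Adj k u := by
  classical
  constructor
  · rintro ⟨⟨hD, hU, hdis, hDU⟩, htl, -⟩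
    refine ⟨hdis, fun k => ⟨?_, ?_⟩⟩
    · rintro (hk | hk)
      · exact ⟨fun d hd => hD d hd k hk, fun u hu => hDU k hk u hu⟩
      · exact ⟨fun d hd => hDU d hd k hk, fun u hu => hU k hk u hu⟩
    · rintro ⟨h1, h2⟩
      by_contra! hk
      -- If `k` were missing, it could replace all elements of `D` to which it points; these are
      -- smaller than `k`, and the result would still be orthogonal.
      refine htl k hk.1 (D.filter fun s => G.Adj k s) (Finset.filter_subset _ _) ?_ ?_
      · intro s hs
        rw [Finset.mem_filter] at hs
        refine ⟨GLE.of_adj hs.2, ?_⟩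
        rintro rfl
        exact ℓ.not_adj_self _ hs.2
      · refine ⟨?_, hU, ?_, ?_⟩
        · intro a ha b hb hab
          simp only [Finset.mem_insert, Finset.mem_sdiff, Finset.mem_filter] at ha hb
          rcases ha with rfl | ⟨ha, ha'⟩ <;> rcases hb with rfl | ⟨hb, hb'⟩
          · exact ℓ.not_adj_self _ hab
          · exact hb' ⟨hb, hab⟩
          · exact h1 a ha hab
          · exact hD a ha b hb hab
        · rw [Finset.disjoint_left] at hdis ⊢
          intro a ha
          simp only [Finset.mem_insert, Finset.mem_sdiff] at ha
          rcases ha with rfl | ha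
          · exact hk.2
          · exact hdis ha.1
        · intro a ha u hu
          simp only [Finset.mem_insert, Finset.mem_sdiff] at ha
          rcases ha with rfl | ha
          · exact h2 u hu
          · exact hDU a ha.1 u hu
  · rintro ⟨hdis, h⟩
    refine ⟨⟨fun a ha b hb => ((h b).1 (Or.inl hb)).1 a ha,
      fun a ha b hb => ((h a).1 (Or.inr ha)).2 b hb, hdis,
      fun d hd u hu => ((h d).1 (Or.inl hd)).2 u hu⟩, ?_, ?_⟩
    · rintro g hg S hS hSg ⟨h1, -, h3, h4⟩
      have hgU : g ∉ U := fun hgU =>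
        Finset.disjoint_left.1 h3 (Finset.mem_insert_self _ _) hgU
      have : ¬ (g ∈ D ∨ g ∈ U) := by tauto
      refine this ((h g).2 ⟨fun d hd hdg => ?_, h4 g (Finset.mem_insert_self _ _)⟩)
      -- Elements of `S` lie below `g`, so none of them has an edge to `g`; the offending `d`
      -- therefore survives the replacement.
      have hdS : d ∉ S := fun hdS => by
        have := ℓ.rank_le (hSg d hdS).1
        have := ℓ.rank_lt hdg
        omega
      exact h1 d (Finset.mem_insert_of_mem (Finset.mem_sdiff.2 ⟨hd, hdS⟩)) g
        (Finset.mem_insert_self _ _) hdg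
    · rintro g hg S hS hSg ⟨-, h1, h3, h4⟩
      have hgD : g ∉ D := fun hgD =>
        Finset.disjoint_right.1 h3 (Finset.mem_insert_self _ _) hgD
      have : ¬ (g ∈ D ∨ g ∈ U) := by tauto
      refine this ((h g).2 ⟨fun d hd => h4 d hd g (Finset.mem_insert_self _ _),
        fun d hd hgd => ?_⟩)
      have hdS : d ∉ S := fun hdS => by
        have := ℓ.rank_le (hSg d hdS).1
        have := ℓ.rank_lt hgd
        omega
      exact h1 g (Finset.mem_insert_self _ _) d
        (Finset.mem_insert_of_mem (Finset.mem_sdiff.2 ⟨hd, hdS⟩)) hgd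

theorem Top.not_mem_U (x : Top G) {k : V} (h : k ∈ x.D) : k ∉ x.U :=
  Finset.disjoint_left.1 x.tight.orthogonal.2.2.1 h

theorem Top.not_adj_D (x : Top G) {d k : V} (hd : d ∈ x.D) (hk : k ∈ x.D ∨ k ∈ x.U) :
    ¬ G.Adj d k :=
  hk.elim (x.tight.orthogonal.1 d hd k) (x.tight.orthogonal.2.2.2 d hd k)

theorem Top.not_adj_U (x : Top G) {k u : V} (hk : k ∈ x.D ∨ k ∈ x.U) (hu : u ∈ x.U) :
    ¬ G.Adj k u :=
  hk.elim (fun hk => x.tight.orthogonal.2.2.2 k hk u hu)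
    fun hk => x.tight.orthogonal.2.1 k hk u hu

theorem LinearExt.mem_or_mem (ℓ : LinearExt G) (x : Top G) {k : V}
    (h₁ : ∀ d ∈ x.D, ¬ G.Adj d k) (h₂ : ∀ u ∈ x.U, ¬ G.Adj k u) : k ∈ x.D ∨ k ∈ x.U :=
  (((ℓ.isTight_iff _ _).1 x.tight).2 k).2 ⟨h₁, h₂⟩

/-- A top is determined by the part of `D` of rank at least `h` and the part of `U` of rank
less than `h`. -/
theorem LinearExt.top_ext [Fintype V] (ℓ : LinearExt G) {x y : Top G} (h : ℕ)
    (hD : ∀ k, h ≤ ℓ.rank k → (k ∈ x.D ↔ k ∈ y.D))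
    (hU : ∀ k, ℓ.rank k < h → (k ∈ x.U ↔ k ∈ y.U)) : x = y := by
  -- Below the cut, `D` is recovered by descending rank: edges into `k` come from `D` already
  -- compared, edges out of `k` reach `U` where agreement is assumed, and agreement of `U` at `k`
  -- decides the side.
  have half : ∀ {x y : Top G}, (∀ k, h ≤ ℓ.rank k → (k ∈ x.D ↔ k ∈ y.D)) →
      (∀ k, ℓ.rank k < h → (k ∈ x.U ↔ k ∈ y.U)) → ∀ k, ℓ.rank k < h →
      (∀ i, ℓ.rank k < ℓ.rank i → (i ∈ x.D ↔ i ∈ y.D)) → k ∈ x.D → k ∈ y.D := by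
    intro x y hD hU k hk ih hx
    refine (ℓ.mem_or_mem y (fun d hd hdk => ?_) fun u hu hku => ?_).resolve_right fun hy => ?_
    · exact x.not_adj_D ((ih d (ℓ.rank_lt hdk)).2 hd) (Or.inl hx) hdk
    · exact x.not_adj_U (Or.inl hx) ((hU u ((ℓ.rank_lt hku).trans hk)).2 hu) hku
    · exact x.not_mem_U hx ((hU k hk).2 hy)
  have half' : ∀ {x y : Top G}, (∀ k, h ≤ ℓ.rank k → (k ∈ x.D ↔ k ∈ y.D)) →
      ∀ k, h ≤ ℓ.rank k →
      (∀ i, ℓ.rank i < ℓ.rank k → (i ∈ x.U ↔ i ∈ y.U)) → k ∈ x.U → k ∈ y.U := by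
    intro x y hD k hk ih hx
    refine (ℓ.mem_or_mem y (fun d hd hdk => ?_) fun u hu hku => ?_).resolve_left fun hy => ?_
    · exact x.not_adj_D ((hD d (hk.trans (ℓ.rank_lt hdk).le)).2 hd) (Or.inr hx) hdk
    · exact x.not_adj_U (Or.inr hx) ((ih u (ℓ.rank_lt hku)).2 hu) hku
    · exact x.not_mem_U ((hD k hk).2 hy) hx
  have hD' : ∀ m k, Fintype.card V ≤ ℓ.rank k + m → (k ∈ x.D ↔ k ∈ y.D) := by
    intro m
    induction m with
    | zero => intro k hk; have := ℓ.rank_lt_card k; omega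
    | succ m ih =>
      intro k hk
      rcases le_or_gt h (ℓ.rank k) with h' | h'
      · exact hD k h'
      · have ih' : ∀ i, ℓ.rank k < ℓ.rank i → (i ∈ x.D ↔ i ∈ y.D) := fun i hi => ih i (by omega)
        exact ⟨half hD hU k h' ih', half (fun k hk => (hD k hk).symm)
          (fun k hk => (hU k hk).symm) k h' fun i hi => (ih' i hi).symm⟩
  have hU' : ∀ m k, ℓ.rank k < m → (k ∈ x.U ↔ k ∈ y.U) := by
    intro m
    induction m with
    | zero => intro k hk; omega
    | succ m ih =>
      intro k hk
      rcases lt_or_ge (ℓ.rank k) h with h' | h'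
      · exact hU k h'
      · have ih' : ∀ i, ℓ.rank i < ℓ.rank k → (i ∈ x.U ↔ i ∈ y.U) := fun i hi => ih i (by omega)
        exact ⟨half' hD k h' ih', half' (fun k hk => (hD k hk).symm) k h' fun i hi =>
          (ih' i hi).symm⟩
  ext k
  · exact hD' _ k le_add_self
  · exact hU' _ k (Nat.lt_succ_self _)

/-- A top with prescribed part of `D` of rank at least `h` and prescribed part of `U` of rank
less than `h`. -/
theorem LinearExt.exists_top (ℓ : LinearExt G) (h : ℕ) (D₀ U₀ : Finset V)
    (hD₀ : IsIndep G D₀) (hU₀ : IsIndep G U₀) (hDU : ∀ d ∈ D₀, ∀ u ∈ U₀, ¬ G.Adj d u)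
    (hDh : ∀ k ∈ D₀, h ≤ ℓ.rank k) (hUh : ∀ k ∈ U₀, ℓ.rank k < h) :
    ∃ x : Top G, (∀ k, h ≤ ℓ.rank k → (k ∈ x.D ↔ k ∈ D₀)) ∧
      (∀ k, ℓ.rank k < h → (k ∈ x.U ↔ k ∈ U₀)) := by
  -- `D` is completed only at ranks below `h`, then `U` only at ranks at least `h`, so neither
  -- completion disturbs the prescribed parts.
  obtain ⟨D, hD⟩ := ℓ.exists_greedy_left
    (fun k => ℓ.rank k < h ∧ k ∉ U₀ ∧ ∀ u ∈ U₀, ¬ G.Adj k u) D₀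
  obtain ⟨U, hU⟩ := ℓ.exists_greedy_right
    (fun k => h ≤ ℓ.rank k ∧ k ∉ D ∧ ∀ d ∈ D, ¬ G.Adj d k) U₀
  have hDD : ∀ k, h ≤ ℓ.rank k → (k ∈ D ↔ k ∈ D₀) := fun k hk =>
    ⟨fun hkD => ((hD k).1 hkD).resolve_right fun h' => absurd h'.1.1 (by omega),
      fun hk => (hD k).2 (Or.inl hk)⟩
  have hUU : ∀ k, ℓ.rank k < h → (k ∈ U ↔ k ∈ U₀) := fun k hk =>
    ⟨fun hkU => ((hU k).1 hkU).resolve_right fun h' => absurd h'.1.1 (by omega),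
      fun hk => (hU k).2 (Or.inl hk)⟩
  have hDU₀ : ∀ d ∈ D, ∀ u ∈ U₀, ¬ G.Adj d u := by
    intro d hd u hu
    rcases (hD d).1 hd with hd | hd
    · exact hDU d hd u hu
    · exact hd.1.2.2 u hu
  have hDUall : ∀ d ∈ D, ∀ u ∈ U, ¬ G.Adj d u := by
    intro d hd u hu
    rcases (hU u).1 hu with hu | hu
    · exact hDU₀ d hd u hu
    · exact hu.1.2.2 d hd
  refine ⟨⟨D, U, (ℓ.isTight_iff D U).2 ⟨?_, fun k => ⟨?_, ?_⟩⟩⟩, hDD, hUU⟩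
  · rw [Finset.disjoint_left]
    intro k hkD hkU
    rcases (hU k).1 hkU with hk | hk
    · rcases (hD k).1 hkD with hk' | hk'
      · have := hDh k hk'
        have := hUh k hk
        omega
      · exact hk'.1.2.1 hk
    · exact hk.1.2.1 hkD
  · rintro (hk | hk)
    · refine ⟨fun d hd hdk => ?_, hDUall k hk⟩
      rcases (hD k).1 hk with hk' | hk'
      · have := hDh k hk'
        have := ℓ.rank_lt hdk
        exact hD₀ d ((hDD d (by omega)).1 hd) k hk' hdk
      · exact hk'.2 d hd hdk
    · refine ⟨fun d hd => hDUall d hd k hk, fun u hu hku => ?_⟩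
      rcases (hU k).1 hk with hk' | hk'
      · have := hUh k hk'
        have := ℓ.rank_lt hku
        exact hU₀ k hk' u ((hUU u (by omega)).1 hu) hku
      · exact hk'.2 u hu hku
  · rintro ⟨h1, h2⟩
    rcases lt_or_ge (ℓ.rank k) h with hk | hk
    · by_cases hkU : k ∈ U₀
      · exact Or.inr ((hUU k hk).2 hkU)
      · exact Or.inl ((hD k).2 (Or.inr ⟨⟨hk, hkU, fun u hu => h2 u ((hU u).2 (Or.inl hu))⟩, h1⟩))
    · by_cases hkD : k ∈ D
      · exact Or.inl hkD
      · exact Or.inr ((hU k).2 (Or.inr ⟨⟨hk, hkD, h1⟩, h2⟩))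

end Tops
-- Flips in rank coordinates
section Flips

variable {V : Type*} [DecidableEq V] {G : Digraph V}

/-- `y` arises from `x` by moving `g` from `U` to `D`, keeping the elements of `D` after `g` and
the elements of `U` before `g` in the given linear extension. -/
structure LinearExt.FlipAt (ℓ : LinearExt G) (g : V) (x y : Top G) : Prop where
  mem_U : g ∈ x.U
  mem_D : g ∈ y.D
  D_iff : ∀ k, ℓ.rank g < ℓ.rank k → (k ∈ x.D ↔ k ∈ y.D)
  U_iff : ∀ k, ℓ.rank k < ℓ.rank g → (k ∈ x.U ↔ k ∈ y.U)

/-- Agreement extends from the ranks after `g` to all vertices not below `g` in `G`-order: sources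
of edges into such a vertex are again not below `g`, so descending rank works. This reconciles the
rank description of a flip with its definition by `G`-order. -/
theorem LinearExt.FlipAt.D_iff_of_not_le [Fintype V] {ℓ : LinearExt G} {g : V} {x y : Top G}
    (h : ℓ.FlipAt g x y) (k : V) (hk : ¬ GLE G k g) : k ∈ x.D ↔ k ∈ y.D := by
  have key : ∀ m k, ¬ GLE G k g → Fintype.card V ≤ ℓ.rank k + m → (k ∈ x.D ↔ k ∈ y.D) := by
    intro m
    induction m with
    | zero => intro k _ hk; have := ℓ.rank_lt_card k; omega
    | succ m ih =>
      intro k hkg hk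
      rcases lt_or_ge (ℓ.rank g) (ℓ.rank k) with hlt | hge
      · exact h.D_iff k hlt
      have hne : ℓ.rank k ≠ ℓ.rank g := fun he =>
        hkg (ℓ.rank_injective he ▸ Relation.ReflTransGen.refl)
      have hlt : ℓ.rank k < ℓ.rank g := by omega
      have hd : ∀ d, G.Adj d k → (d ∈ x.D ↔ d ∈ y.D) := fun d hdk =>
        ih d (fun hdg => hkg ((GLE.of_adj hdk).trans hdg)) (by have := ℓ.rank_lt hdk; omega)
      have hu : ∀ u, G.Adj k u → (u ∈ x.U ↔ u ∈ y.U) := fun u hku =>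
        h.U_iff u ((ℓ.rank_lt hku).trans hlt)
      constructor
      · intro hx
        refine (ℓ.mem_or_mem y (fun d hdy hdk => ?_) fun u huy hku => ?_).resolve_right
          fun hy => x.not_mem_U hx ((h.U_iff k hlt).2 hy)
        · exact x.not_adj_D ((hd d hdk).2 hdy) (Or.inl hx) hdk
        · exact x.not_adj_U (Or.inl hx) ((hu u hku).2 huy) hku
      · intro hy
        refine (ℓ.mem_or_mem x (fun d hdx hdk => ?_) fun u hux hku => ?_).resolve_right
          fun hx => y.not_mem_U hy ((h.U_iff k hlt).1 hx)
        · exact y.not_adj_D ((hd d hdk).1 hdx) (Or.inl hy) hdk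
        · exact y.not_adj_U (Or.inl hy) ((hu u hku).1 hux) hku
  exact key _ k hk le_add_self

theorem LinearExt.FlipAt.U_iff_of_not_le {ℓ : LinearExt G} {g : V} {x y : Top G}
    (h : ℓ.FlipAt g x y) (k : V) (hk : ¬ GLE G g k) : k ∈ x.U ↔ k ∈ y.U := by
  have key : ∀ m k, ¬ GLE G g k → ℓ.rank k < m → (k ∈ x.U ↔ k ∈ y.U) := by
    intro m
    induction m with
    | zero => intro k _ hk; omega
    | succ m ih =>
      intro k hkg hk
      rcases lt_or_ge (ℓ.rank k) (ℓ.rank g) with hlt | hge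
      · exact h.U_iff k hlt
      have hne : ℓ.rank k ≠ ℓ.rank g := fun he =>
        hkg (ℓ.rank_injective he ▸ Relation.ReflTransGen.refl)
      have hlt : ℓ.rank g < ℓ.rank k := by omega
      have hu : ∀ u, G.Adj k u → (u ∈ x.U ↔ u ∈ y.U) := fun u hku =>
        ih u (fun hdg => hkg (hdg.trans (GLE.of_adj hku))) (by have := ℓ.rank_lt hku; omega)
      have hd : ∀ d, G.Adj d k → (d ∈ x.D ↔ d ∈ y.D) := fun d hdk =>
        h.D_iff d (hlt.trans (ℓ.rank_lt hdk))
      constructor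
      · intro hx
        refine (ℓ.mem_or_mem y (fun d hdy hdk => ?_) fun u huy hku => ?_).resolve_left
          fun hy => x.not_mem_U ((h.D_iff k hlt).2 hy) hx
        · exact x.not_adj_D ((hd d hdk).2 hdy) (Or.inr hx) hdk
        · exact x.not_adj_U (Or.inr hx) ((hu u hku).2 huy) hku
      · intro hy
        refine (ℓ.mem_or_mem x (fun d hdx hdk => ?_) fun u hux hku => ?_).resolve_left
          fun hx => y.not_mem_U ((h.D_iff k hlt).1 hx) hy
        · exact y.not_adj_D ((hd d hdk).1 hdx) (Or.inr hy) hdk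
        · exact y.not_adj_U (Or.inr hy) ((hu u hku).1 hux) hku
  exact key _ k hk (Nat.lt_succ_self _)

/-- Both completion passes are characterized by recursions. A flip computed greedily keeps the two
rank parts, and conversely a top with those parts satisfies the recursions and so equals the greedy
output. -/
theorem flipUp_iff [Fintype V] (ℓ : LinearExt G) (ℓ' : RevLinearExt G) (x y : Top G) :
    FlipUp ℓ ℓ' x y ↔ ∃ g, ℓ.FlipAt g x y := by
  classical
  constructor
  · rintro ⟨g, hg, h⟩
    refine ⟨g, ?_⟩
    rw [flip, if_pos hg, complete, Prod.mk.injEq] at h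
    obtain ⟨hD, hU⟩ := h
    rw [hD] at hU
    have mD := mem_fillD ℓ' g (insert g (x.D.filter fun k => ¬ GLE G k g))
      (x.U.filter fun k => ¬ GLE G g k)
    have mU := mem_fillU ℓ g y.D (x.U.filter fun k => ¬ GLE G g k)
    rw [hD] at mD
    rw [hU] at mU
    have hD₁ : ∀ k ∈ x.D, ¬ GLE G k g → k ∈ y.D := fun k hk hkg =>
      (mD k).2 (Or.inl (Finset.mem_insert_of_mem (Finset.mem_filter.2 ⟨hk, hkg⟩)))
    have hU₁ : ∀ k ∈ x.U, ¬ GLE G g k → k ∈ y.U := fun k hk hkg =>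
      (mU k).2 (Or.inl (Finset.mem_filter.2 ⟨hk, hkg⟩))
    have hgD : g ∈ y.D := (mD g).2 (Or.inl (Finset.mem_insert_self _ _))
    refine ⟨hg, hgD, fun k hk => ⟨fun hx => hD₁ k hx fun hkg => ?_, fun hy => ?_⟩,
      fun k hk => ⟨fun hx => hU₁ k hx fun hkg => ?_, fun hy => ?_⟩⟩
    · have := ℓ.rank_le hkg
      omega
    · have hkg : ¬ GLE G k g := fun hkg => by have := ℓ.rank_le hkg; omega
      rcases (mD k).1 hy with h | ⟨⟨h1, h2, h3⟩, h4⟩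
      · rw [Finset.mem_insert, Finset.mem_filter] at h
        rcases h with rfl | h
        · omega
        · exact h.1
      · refine (ℓ.mem_or_mem x (fun d hd hdk => ?_) fun u hu hku => ?_).resolve_right
          fun hx => h2 (Finset.mem_filter.2 ⟨hx, h1⟩)
        · exact h4 d (hD₁ d hd fun hdg => hkg ((GLE.of_adj hdk).trans hdg)) hdk
        · exact h3 u (Finset.mem_filter.2 ⟨hu, fun hgu => h1 (hgu.trans (GLE.of_adj hku))⟩) hku
    · have := ℓ.rank_le hkg
      omega
    · have hkg : ¬ GLE G g k := fun hkg => by have := ℓ.rank_le hkg; omega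
      rcases (mU k).1 hy with h | ⟨⟨h1, h2, h3⟩, h4⟩
      · exact (Finset.mem_filter.1 h).1
      · refine (ℓ.mem_or_mem x (fun d hd hdk => ?_) fun u hu hku => ?_).resolve_left
          fun hx => h2 (hD₁ k hx h1)
        · exact h3 d (hD₁ d hd fun hdg => h1 ((GLE.of_adj hdk).trans hdg)) hdk
        · exact h4 u (hU₁ u hu fun hgu => hkg (hgu.trans (GLE.of_adj hku))) hku
  · rintro ⟨g, h⟩
    have hgU : g ∉ y.U := y.not_mem_U h.mem_D
    refine ⟨g, h.mem_U, ?_⟩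
    have hU₁ : ∀ k, k ∈ x.U.filter (fun k => ¬ GLE G g k) ↔ k ∈ y.U ∧ ¬ GLE G g k := by
      intro k
      rw [Finset.mem_filter]
      refine and_congr_left fun hk => h.U_iff_of_not_le k hk
    have hD₁ : ∀ k, k ∈ insert g (x.D.filter fun k => ¬ GLE G k g) ↔
        k = g ∨ (k ∈ y.D ∧ ¬ GLE G k g) := by
      intro k
      rw [Finset.mem_insert, Finset.mem_filter]
      refine or_congr_right (and_congr_left fun hk => h.D_iff_of_not_le k hk)
    have hD : fillD G g ℓ'.toList (insert g (x.D.filter fun k => ¬ GLE G k g))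
        (x.U.filter fun k => ¬ GLE G g k) = y.D := by
      refine ℓ.greedy_left_unique (mem_fillD ℓ' g _ _) fun k => ⟨fun hk => ?_, ?_⟩
      · rw [hD₁]
        by_cases hkg : k = g
        · exact Or.inl (Or.inl hkg)
        by_cases hle : GLE G k g
        · refine Or.inr ⟨⟨fun hgk => hkg ?_, fun hkU => ?_, fun u hu => ?_⟩,
            fun d hd => y.not_adj_D hd (Or.inl hk)⟩
          · exact ℓ.rank_injective (le_antisymm (ℓ.rank_le hle) (ℓ.rank_le hgk))
          · exact y.not_mem_U hk ((hU₁ k).1 hkU).1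
          · exact y.not_adj_U (Or.inl hk) ((hU₁ u).1 hu).1
        · exact Or.inl (Or.inr ⟨hk, hle⟩)
      · rw [hD₁]
        rintro ((rfl | hk) | ⟨⟨h1, h2, h3⟩, h4⟩)
        · exact h.mem_D
        · exact hk.1
        · refine (ℓ.mem_or_mem y h4 fun u hu hku => ?_).resolve_right
            fun hy => h2 ((hU₁ k).2 ⟨hy, h1⟩)
          exact h3 u ((hU₁ u).2 ⟨hu, fun hgu => h1 (hgu.trans (GLE.of_adj hku))⟩) hku
    have hU : fillU G g ℓ.toList y.D (x.U.filter fun k => ¬ GLE G g k) = y.U := by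
      refine ℓ.greedy_right_unique (mem_fillU ℓ g _ _) fun k => ⟨fun hk => ?_, ?_⟩
      · rw [hU₁]
        by_cases hle : GLE G g k
        · refine Or.inr ⟨⟨fun hkg => hgU ?_, fun hkD => y.not_mem_U hkD hk,
            fun d hd => y.not_adj_D hd (Or.inr hk)⟩, fun u hu => y.not_adj_U (Or.inr hk) hu⟩
          exact ℓ.rank_injective (le_antisymm (ℓ.rank_le hkg) (ℓ.rank_le hle)) ▸ hk
        · exact Or.inl ⟨hk, hle⟩
      · rw [hU₁]
        rintro (hk | ⟨⟨h1, h2, h3⟩, h4⟩)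
        · exact hk.1
        · exact (ℓ.mem_or_mem y h3 h4).resolve_left h2
    rw [flip, if_pos h.mem_U, complete, Prod.mk.injEq]
    refine ⟨?_, ?_⟩
    · convert hD
    · convert hU

/-- The target is prescribed at the cut `rank g`: `D` consists of `g` and the later part of `x.D`,
and `U` of the earlier part of `x.U`. -/
theorem LinearExt.exists_flipAt (ℓ : LinearExt G) {x : Top G} {g : V} (hg : g ∈ x.U) :
    ∃ y, ℓ.FlipAt g x y := by
  classical
  have hxg : ∀ k, k ∈ insert g (x.D.filter fun k => ℓ.rank g < ℓ.rank k) ↔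
      k = g ∨ (k ∈ x.D ∧ ℓ.rank g < ℓ.rank k) := by simp
  have hxu : ∀ k, k ∈ x.U.filter (fun k => ℓ.rank k < ℓ.rank g) ↔
      k ∈ x.U ∧ ℓ.rank k < ℓ.rank g := by simp
  obtain ⟨y, hD, hU⟩ := ℓ.exists_top (ℓ.rank g)
    (insert g (x.D.filter fun k => ℓ.rank g < ℓ.rank k))
    (x.U.filter fun k => ℓ.rank k < ℓ.rank g) (by
      intro a ha b hb hab
      rw [hxg] at ha hb
      have := ℓ.rank_lt hab
      rcases ha with rfl | ha
      · rcases hb with rfl | hb <;> omega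
      · exact x.not_adj_D ha.1 (hb.elim (fun h => Or.inr (h ▸ hg)) fun h => Or.inl h.1) hab) (by
      intro a ha b hb
      rw [hxu] at ha hb
      exact x.not_adj_U (Or.inr ha.1) hb.1) (by
      intro a ha b hb
      rw [hxg] at ha
      rw [hxu] at hb
      exact x.not_adj_U (ha.elim (fun h => Or.inr (h ▸ hg)) fun h => Or.inl h.1) hb.1) (by
      intro k hk
      rw [hxg] at hk
      rcases hk with rfl | hk
      · exact le_rfl
      · exact hk.2.le) (by
      intro k hk
      exact ((hxu k).1 hk).2)
  refine ⟨y, hg, (hD g le_rfl).2 (Finset.mem_insert_self _ _), fun k hk => ?_, fun k hk => ?_⟩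
  · rw [hD k hk.le, hxg]
    refine ⟨fun h => Or.inr ⟨h, hk⟩, ?_⟩
    rintro (rfl | h)
    · omega
    · exact h.1
  · rw [hU k hk, hxu]
    exact ⟨fun h => ⟨h, hk⟩, fun h => h.1⟩

theorem LinearExt.exists_flipAt_of_mem_D (ℓ : LinearExt G) {y : Top G} {g : V} (hg : g ∈ y.D) :
    ∃ x, ℓ.FlipAt g x y := by
  classical
  have hyd : ∀ k, k ∈ y.D.filter (fun k => ℓ.rank g < ℓ.rank k) ↔
      k ∈ y.D ∧ ℓ.rank g < ℓ.rank k := by simp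
  have hyu : ∀ k, k ∈ insert g (y.U.filter fun k => ℓ.rank k < ℓ.rank g) ↔
      k = g ∨ (k ∈ y.U ∧ ℓ.rank k < ℓ.rank g) := by simp
  -- The cut is `rank g + 1`, not `rank g`, because `g` now has to be prescribed on the `U` side.
  obtain ⟨x, hD, hU⟩ := ℓ.exists_top (ℓ.rank g + 1)
    (y.D.filter fun k => ℓ.rank g < ℓ.rank k)
    (insert g (y.U.filter fun k => ℓ.rank k < ℓ.rank g)) (by
      intro a ha b hb
      rw [hyd] at ha hb
      exact y.not_adj_D ha.1 (Or.inl hb.1)) (by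
      intro a ha b hb hab
      rw [hyu] at ha hb
      have := ℓ.rank_lt hab
      rcases hb with rfl | hb
      · rcases ha with rfl | ha <;> omega
      · exact y.not_adj_U (ha.elim (fun h => Or.inl (h ▸ hg)) fun h => Or.inr h.1) hb.1 hab) (by
      intro a ha b hb
      rw [hyd] at ha
      rw [hyu] at hb
      exact y.not_adj_D ha.1 (hb.elim (fun h => Or.inl (h ▸ hg)) fun h => Or.inr h.1)) (by
      intro k hk
      exact ((hyd k).1 hk).2) (by
      intro k hk
      rw [hyu] at hk
      rcases hk with rfl | hk <;> omega)
  refine ⟨x, (hU g (Nat.lt_succ_self _)).2 (Finset.mem_insert_self _ _), hg, fun k hk => ?_,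
    fun k hk => ?_⟩
  · rw [hD k hk, hyd]
    exact ⟨fun h => h.1, fun h => ⟨h, hk⟩⟩
  · rw [hU k (hk.trans (Nat.lt_succ_self _)), hyu]
    refine ⟨?_, fun h => Or.inr ⟨h, hk⟩⟩
    rintro (rfl | h)
    · omega
    · exact h.1

/-! ### Sufficient and necessary conditions for comparability -/

variable [Fintype V] {ℓ : LinearExt G} {ℓ' : RevLinearExt G}

theorem LinearExt.FlipAt.le {g : V} {x y : IndepPoset G ℓ ℓ'} (h : ℓ.FlipAt g x y) : x ≤ y :=
  Relation.ReflTransGen.single ((flipUp_iff ℓ ℓ' x y).2 ⟨g, h⟩)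

theorem IndepPoset.le_induction {x : IndepPoset G ℓ ℓ'} {P : IndepPoset G ℓ ℓ' → Prop}
    (hx : P x) (h : ∀ y z g, x ≤ y → ℓ.FlipAt g y z → P y → P z) {y : IndepPoset G ℓ ℓ'}
    (hxy : x ≤ y) : P y := by
  change Relation.ReflTransGen (FlipUp ℓ ℓ') x y at hxy
  induction hxy with
  | refl => exact hx
  | tail h1 h2 ih =>
    obtain ⟨g, hg⟩ := (flipUp_iff _ _ _ _).1 h2
    exact h _ _ g h1 hg ih

/-- The cut is raised one vertex at a time. If the vertex `g` at the cut breaks the agreement of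
`U`, then `g ∈ x.U \ y.U`, and flipping `x` up at `g` restores the agreement while keeping `D` after
`g`. At cut `|V|` the tops coincide. -/
theorem IndepPoset.le_of_D_subset (h : ℕ) {x y : IndepPoset G ℓ ℓ'}
    (hU : ∀ k, ℓ.rank k < h → (k ∈ x.U ↔ k ∈ y.U))
    (hD : ∀ k, h ≤ ℓ.rank k → k ∈ x.D → k ∈ y.D) : x ≤ y := by
  have key : ∀ m h, Fintype.card V ≤ h + m → ∀ {x y : IndepPoset G ℓ ℓ'},
      (∀ k, ℓ.rank k < h → (k ∈ x.U ↔ k ∈ y.U)) →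
      (∀ k, h ≤ ℓ.rank k → k ∈ x.D → k ∈ y.D) → x ≤ y := by
    intro m
    induction m with
    | zero =>
      intro h hh x y hU hD
      refine le_of_eq (ℓ.top_ext h (fun k hk => ?_) hU)
      have := ℓ.rank_lt_card k
      omega
    | succ m ih =>
      intro h hh x y hU hD
      rcases lt_or_ge h (Fintype.card V) with hlt | hge
      swap
      · exact ih h (by omega) hU hD
      obtain ⟨g, rfl⟩ := ℓ.exists_rank_eq hlt
      by_cases hg : g ∈ x.U ↔ g ∈ y.U
      · refine ih (ℓ.rank g + 1) (by omega) (fun k hk => ?_) fun k hk => hD k (by omega)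
        rcases Nat.lt_succ_iff_lt_or_eq.1 hk with hk | hk
        · exact hU k hk
        · rwa [ℓ.rank_injective hk]
      · have hyx : g ∈ y.U → g ∈ x.U := by
          intro hgy
          refine (ℓ.mem_or_mem x (fun d hd hdg => ?_) fun u hu hgu => ?_).resolve_left
            fun hgx => y.not_mem_U (hD g le_rfl hgx) hgy
          · exact y.not_adj_D (hD d (ℓ.rank_lt hdg).le hd) (Or.inr hgy) hdg
          · exact y.not_adj_U (Or.inr hgy) ((hU u (ℓ.rank_lt hgu)).1 hu) hgu
        have hgx : g ∈ x.U := by tauto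
        have hgy : g ∉ y.U := by tauto
        obtain ⟨z, hz⟩ := ℓ.exists_flipAt hgx
        refine hz.le.trans (ih (ℓ.rank g + 1) (by omega) (fun k hk => ?_) fun k hk hkz => ?_)
        · rcases Nat.lt_succ_iff_lt_or_eq.1 hk with hk | hk
          · exact (hz.U_iff k hk).symm.trans (hU k hk)
          · rw [ℓ.rank_injective hk]
            exact iff_of_false (z.not_mem_U hz.mem_D) hgy
        · exact hD k (by omega) ((hz.D_iff k hk).2 hkz)
  exact key _ h le_add_self hU hD

/-- Dual argument: the cut is lowered, and `y` is flipped down at each vertex where the `D` parts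
differ. -/
theorem IndepPoset.le_of_U_subset (h : ℕ) {x y : IndepPoset G ℓ ℓ'}
    (hD : ∀ k, h ≤ ℓ.rank k → (k ∈ x.D ↔ k ∈ y.D))
    (hU : ∀ k, ℓ.rank k < h → k ∈ y.U → k ∈ x.U) : x ≤ y := by
  induction h generalizing y with
  | zero => exact le_of_eq (ℓ.top_ext 0 hD fun k hk => by omega)
  | succ h ih =>
    rcases lt_or_ge h (Fintype.card V) with hlt | hge
    swap
    · refine ih (fun k hk => ?_) fun k hk => hU k (by omega)
      have := ℓ.rank_lt_card k
      omega
    obtain ⟨g, rfl⟩ := ℓ.exists_rank_eq hlt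
    by_cases hg : g ∈ x.D ↔ g ∈ y.D
    · refine ih (fun k hk => ?_) fun k hk => hU k (by omega)
      rcases Nat.lt_or_eq_of_le hk with hk | hk
      · exact hD k hk
      · rwa [← ℓ.rank_injective hk]
    · have hxy : g ∈ x.D → g ∈ y.D := by
        intro hgx
        refine (ℓ.mem_or_mem y (fun d hd hdg => ?_) fun u hu hgu => ?_).resolve_right
          fun hgy => x.not_mem_U hgx (hU g (Nat.lt_succ_self _) hgy)
        · exact x.not_adj_D ((hD d (ℓ.rank_lt hdg)).2 hd) (Or.inl hgx) hdg
        · exact x.not_adj_U (Or.inl hgx) (hU u ((ℓ.rank_lt hgu).trans (Nat.lt_succ_self _)) hu) hgu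
      have hgy : g ∈ y.D := by tauto
      have hgx : g ∉ x.D := by tauto
      obtain ⟨z, hz⟩ := ℓ.exists_flipAt_of_mem_D hgy
      refine le_trans (ih (fun k hk => ?_) fun k hk hkz => ?_) hz.le
      · rcases Nat.lt_or_eq_of_le hk with hk | hk
        · exact (hD k hk).trans (hz.D_iff k hk).symm
        · rw [← ℓ.rank_injective hk]
          exact iff_of_false hgx fun hgz => z.not_mem_U hgz hz.mem_U
      · exact hU k (by omega) ((hz.U_iff k hk).1 hkz)

/-- The tops whose `U` avoids all vertices of rank less than `h` form an upper set. -/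
theorem IndepPoset.forall_not_mem_U_mono (h : ℕ) {x y : IndepPoset G ℓ ℓ'} (hxy : x ≤ y)
    (hx : ∀ k, ℓ.rank k < h → k ∉ x.U) : ∀ k, ℓ.rank k < h → k ∉ y.U := by
  refine IndepPoset.le_induction (P := fun y => ∀ k, ℓ.rank k < h → k ∉ y.U) hx ?_ hxy
  intro y z g _ hg hy k hk hkz
  have hgh : h ≤ ℓ.rank g := by
    by_contra! hgh
    exact hy g hgh hg.mem_U
  exact hy k hk ((hg.U_iff k (by omega)).2 hkz)

/-- Above a top whose `U` avoids all vertices of rank less than `h`, the part of `D` of rank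
at least `h` grows in colexicographic order. -/
theorem IndepPoset.colex_le (h : ℕ) {x y : IndepPoset G ℓ ℓ'} (hxy : x ≤ y)
    (hx : ∀ k, ℓ.rank k + 1 < h → k ∉ x.U) :
    toColex ((x.D.filter fun k => h ≤ ℓ.rank k).image ℓ.rank) ≤
      toColex ((y.D.filter fun k => h ≤ ℓ.rank k).image ℓ.rank) := by
  classical
  refine IndepPoset.le_induction (P := fun y =>
    toColex ((x.D.filter fun k => h ≤ ℓ.rank k).image ℓ.rank) ≤
      toColex ((y.D.filter fun k => h ≤ ℓ.rank k).image ℓ.rank)) le_rfl ?_ hxy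
  intro y z g hxy hg hle
  refine hle.trans ?_
  -- A flip at rank `h - 1` is allowed as well: it leaves `D` at ranks at least `h` unchanged. This
  -- slack is needed where `x` still has the vertex of rank `h - 1` in `U`.
  have hgh : h ≤ ℓ.rank g + 1 := by
    by_contra! hgh
    refine IndepPoset.forall_not_mem_U_mono (h - 1) hxy (fun k hk => hx k (by omega)) g
      (by omega) hg.mem_U
  rcases Nat.lt_or_eq_of_le hgh with hlt | heq
  · refine le_of_lt ?_
    rw [Finset.Colex.toColex_lt_toColex_iff_exists_forall_lt]
    refine ⟨_, Finset.mem_image_of_mem _ (Finset.mem_filter.2 ⟨hg.mem_D, by omega⟩), ?_, ?_⟩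
    · rw [Finset.mem_image]
      rintro ⟨a, ha, hag⟩
      rw [ℓ.rank_injective hag] at ha
      exact y.not_mem_U (Finset.mem_filter.1 ha).1 hg.mem_U
    · intro i hi hi2
      obtain ⟨b, hb, rfl⟩ := Finset.mem_image.1 hi
      rw [Finset.mem_filter] at hb
      by_contra! hgb
      rcases Nat.lt_or_eq_of_le hgb with hgb | hgb
      · exact hi2 (Finset.mem_image_of_mem _
          (Finset.mem_filter.2 ⟨(hg.D_iff b hgb).1 hb.1, hb.2⟩))
      · rw [← ℓ.rank_injective hgb] at hb
        exact y.not_mem_U hb.1 hg.mem_U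
  · refine le_of_eq ?_
    congr 2
    ext k
    simp only [Finset.mem_filter]
    exact and_congr_left fun hk => hg.D_iff k (by omega)

/-- If `D` of two comparable tops agree beyond some rank, so does every top in between. -/
theorem IndepPoset.D_iff_of_le_of_le (h : ℕ) {x w z : IndepPoset G ℓ ℓ'} (hxw : x ≤ w)
    (hwz : w ≤ z) (hx : ∀ k, ℓ.rank k + 1 < h → k ∉ x.U)
    (hxz : ∀ k, h ≤ ℓ.rank k → (k ∈ x.D ↔ k ∈ z.D)) (k : V) (hk : h ≤ ℓ.rank k) :
    k ∈ w.D ↔ k ∈ z.D := by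
  have h1 := IndepPoset.colex_le h hxw hx
  have h2 := IndepPoset.colex_le h hwz fun k hk =>
    IndepPoset.forall_not_mem_U_mono (h - 1) hxw (fun k hk => hx k (by omega)) k (by omega)
  have h3 : (x.D.filter fun k => h ≤ ℓ.rank k) = z.D.filter fun k => h ≤ ℓ.rank k := by
    ext k
    simp only [Finset.mem_filter]
    exact and_congr_left fun hk => hxz k hk
  rw [h3] at h1
  have h4 := congrArg (fun c => ofColex c) (le_antisymm h2 h1)
  have h5 := Finset.image_injective ℓ.rank_injective h4
  have := congrArg (fun s => k ∈ s) h5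
  simpa [hk] using this

end Flips
-- The lattice case
section Trim

variable {V : Type*} [DecidableEq V] [Fintype V] {G : Digraph V} {ℓ : LinearExt G}
  {ℓ' : RevLinearExt G}

theorem LinearExt.FlipAt.ne {V : Type*} [DecidableEq V] {G : Digraph V} {ℓ : LinearExt G} {g : V}
    {x y : Top G} (h : ℓ.FlipAt g x y) : x ≠ y := by
  rintro rfl
  exact x.not_mem_U h.mem_D h.mem_U

theorem IndepPoset.exists_flipAt_of_covBy {x y : IndepPoset G ℓ ℓ'} (h : x ⋖ y) :
    ∃ g, ℓ.FlipAt g x y := by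
  have hle : Relation.ReflTransGen (FlipUp ℓ ℓ') x y := h.le
  rcases hle.cases_head with heq | ⟨z, hxz, hzy⟩
  · exact absurd heq h.ne
  · obtain ⟨g, hg⟩ := (flipUp_iff _ _ _ _).1 hxz
    rcases CovBy.eq_or_eq (α := IndepPoset G ℓ ℓ') h hg.le hzy with hz | hz
    · exact absurd hz.symm hg.ne
    · exact ⟨g, hz ▸ hg⟩

/-- At cut `0` with `x = j g` and `y = m g` this says `j g ≰ m g`. The cut `h` is pushed up to `rank
g`, flipping `x` when the vertex `v` at the cut lies in `x.U`. The flipped top is `x ⊔ a` for a top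
`a ≤ y`, so it stays below `y`; this is where joins are needed. At `h = rank g` the set `x.U` avoids
all ranks up to `rank g`, a property inherited by larger tops but violated by `y`. -/
theorem IndepPoset.not_le_of_D_eq_of_U_eq (hL : IsLatticePoset (IndepPoset G ℓ ℓ')) {g : V}
    {y : IndepPoset G ℓ ℓ'} (hy : ∀ k, k ∈ y.U ↔ k = g) (h : ℕ) (hg : h ≤ ℓ.rank g)
    {x : IndepPoset G ℓ ℓ'} (hxU : ∀ k, ℓ.rank k < h → k ∉ x.U)
    (hxD : ∀ k, h ≤ ℓ.rank k → (k ∈ x.D ↔ k = g)) : ¬ x ≤ y := by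
  induction hg using Nat.decreasingInduction generalizing x with
  | self =>
    intro hxy
    refine IndepPoset.forall_not_mem_U_mono (ℓ.rank g + 1) hxy (fun k hk => ?_) g
      (Nat.lt_succ_self _) ((hy g).2 rfl)
    rcases Nat.lt_succ_iff_lt_or_eq.1 hk with hk | hk
    · exact hxU k hk
    · rw [ℓ.rank_injective hk]
      exact x.not_mem_U ((hxD g le_rfl).2 rfl)
  | of_succ h hg ih =>
    intro hxy
    obtain ⟨v, rfl⟩ := ℓ.exists_rank_eq (hg.trans (ℓ.rank_lt_card g))
    by_cases hv : v ∈ x.U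
    · obtain ⟨z, hz⟩ := ℓ.exists_flipAt hv
      have hzU : ∀ k, ℓ.rank k < ℓ.rank v + 1 → k ∉ z.U := by
        intro k hk
        rcases Nat.lt_succ_iff_lt_or_eq.1 hk with hk | hk
        · rw [← hz.U_iff k hk]
          exact hxU k hk
        · rw [ℓ.rank_injective hk]
          exact z.not_mem_U hz.mem_D
      have hxz : ∀ k, ℓ.rank v + 1 ≤ ℓ.rank k → (k ∈ x.D ↔ k ∈ z.D) := fun k hk =>
        hz.D_iff k hk
      refine ih (x := z) hzU (fun k hk => ?_) ?_
      · rw [← hxz k hk]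
        exact hxD k (by omega)
      -- `a` is the least top whose `U` avoids all ranks up to `rank v`; both `z` and `y` are such
      -- tops, the latter because `rank v < rank g`.
      obtain ⟨a, haD, haU⟩ : ∃ a : IndepPoset G ℓ ℓ', _ ∧ _ := ℓ.exists_top (ℓ.rank v + 1) ∅ ∅ (by simp [IsIndep])
        (by simp [IsIndep]) (by simp) (by simp) (by simp)
      have hay : ∀ {t : IndepPoset G ℓ ℓ'}, (∀ k, ℓ.rank k < ℓ.rank v + 1 → k ∉ t.U) →
          a ≤ t := fun ht =>
        IndepPoset.le_of_D_subset (ℓ.rank v + 1)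
          (fun k hk => iff_of_false (by simp [haU k hk]) (ht k hk))
          (fun k hk hka => by simp [haD k hk] at hka)
      obtain ⟨w, hw⟩ := (hL x a).1
      have hxw : x ≤ w := hw.1 (by simp)
      have haw : a ≤ w := hw.1 (by simp)
      have hwz : w ≤ z := hw.2 (by
        rintro t (rfl | rfl)
        · exact hz.le
        · exact hay hzU)
      have hwy : w ≤ y := hw.2 (by
        rintro t (rfl | rfl)
        · exact hxy
        · refine hay fun k hk => ?_
          rw [hy]
          rintro rfl
          omega)
      have hwU := IndepPoset.forall_not_mem_U_mono (ℓ.rank v + 1) haw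
        (fun k hk => by simp [haU k hk])
      have hwD := IndepPoset.D_iff_of_le_of_le (ℓ.rank v + 1) hxw hwz
        (fun k hk => hxU k (by omega)) hxz
      -- Being above `a` fixes `U` of the join up to `rank v`, and lying between `x` and `z` fixes
      -- its `D` beyond that rank; so the join is the flip `z`.
      have : w = z := ℓ.top_ext (ℓ.rank v + 1) hwD fun k hk =>
        iff_of_false (hwU k hk) (hzU k hk)
      exact this ▸ hwy
    · refine ih (fun k hk => ?_) (fun k hk => hxD k (by omega)) hxy
      rcases Nat.lt_succ_iff_lt_or_eq.1 hk with hk | hk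
      · exact hxU k hk
      · rwa [ℓ.rank_injective hk]

theorem IndepPoset.isTrimLatticePoset (hL : IsLatticePoset (IndepPoset G ℓ ℓ')) :
    IsTrimLatticePoset (IndepPoset G ℓ ℓ') := by
  have hj : ∀ g : V, ∃ x : IndepPoset G ℓ ℓ', ∀ k, k ∈ x.D ↔ k = g := by
    intro g
    obtain ⟨x, hx, -⟩ := ℓ.exists_top 0 {g} ∅ (by simp [IsIndep, ℓ.not_adj_self])
      (by simp [IsIndep]) (by simp) (by simp) (by simp)
    exact ⟨x, fun k => by simpa using hx k (Nat.zero_le _)⟩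
  have hm : ∀ g : V, ∃ x : IndepPoset G ℓ ℓ', ∀ k, k ∈ x.U ↔ k = g := by
    intro g
    obtain ⟨x, -, hx⟩ := ℓ.exists_top (Fintype.card V) ∅ {g} (by simp [IsIndep])
      (by simp [IsIndep, ℓ.not_adj_self]) (by simp) (by simp) (by simp [ℓ.rank_lt_card])
    exact ⟨x, fun k => by simpa using hx k (ℓ.rank_lt_card k)⟩
  have hs : ∀ i : ℕ, ∃ x : IndepPoset G ℓ ℓ', (∀ k, i ≤ ℓ.rank k → k ∉ x.D) ∧
      ∀ k, ℓ.rank k < i → k ∉ x.U := by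
    intro i
    obtain ⟨x, hD, hU⟩ := ℓ.exists_top i ∅ ∅ (by simp [IsIndep]) (by simp [IsIndep]) (by simp)
      (by simp) (by simp)
    exact ⟨x, fun k hk => by simp [hD k hk], fun k hk => by simp [hU k hk]⟩
  choose j hj using hj
  choose m hm using hm
  choose s hsD hsU using hs
  have hfin : Finite (IndepPoset G ℓ ℓ') := by
    refine Finite.of_injective (β := Finset V × Finset V)
      (fun x : IndepPoset G ℓ ℓ' => (x.D, x.U)) fun x y h => ?_
    rw [Prod.mk.injEq] at h
    exact Top.ext h.1 h.2
  have hjx : ∀ (x : IndepPoset G ℓ ℓ') g, g ∈ x.D → j g ≤ x := fun x g hg =>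
    IndepPoset.le_of_D_subset 0 (fun k hk => by omega) fun k _ hk => by rwa [(hj g k).1 hk]
  have hxm : ∀ (x : IndepPoset G ℓ ℓ') g, g ∈ x.U → x ≤ m g := fun x g hg =>
    IndepPoset.le_of_U_subset (Fintype.card V)
      (fun k hk => by have := ℓ.rank_lt_card k; omega) fun k _ hk => by rwa [(hm g k).1 hk]
  have hjm : ∀ g, ¬ j g ≤ m g := fun g =>
    IndepPoset.not_le_of_D_eq_of_U_eq hL (hm g) 0 (Nat.zero_le _) (fun k hk => by omega)
      fun k _ => hj g k
  have hcov : ∀ x y : IndepPoset G ℓ ℓ', x ⋖ y →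
      ∃ g, j g ≤ y ∧ ¬ j g ≤ x ∧ x ≤ m g ∧ ¬ y ≤ m g := by
    intro x y hxy
    obtain ⟨g, hg⟩ := IndepPoset.exists_flipAt_of_covBy hxy
    have h1 := hjx y g hg.mem_D
    have h2 := hxm x g hg.mem_U
    exact ⟨g, h1, fun h => hjm g (h.trans h2), h2, fun h => hjm g (h1.trans h)⟩
  have hmem_D : ∀ g, g ∈ (s (ℓ.rank g + 1)).D := by
    intro g
    refine (ℓ.mem_or_mem _ (fun d hd hdg => ?_) fun u hu hgu => ?_).resolve_right
      (hsU _ g (Nat.lt_succ_self _))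
    · exact hsD _ d (ℓ.rank_lt hdg) hd
    · exact hsU _ u ((ℓ.rank_lt hgu).trans (Nat.lt_succ_self _)) hu
  have hmem_U : ∀ g, g ∈ (s (ℓ.rank g)).U := by
    intro g
    refine (ℓ.mem_or_mem _ (fun d hd hdg => ?_) fun u hu hgu => ?_).resolve_left
      (hsD _ g le_rfl)
    · exact hsD _ d (ℓ.rank_lt hdg).le hd
    · exact hsU _ u (ℓ.rank_lt hgu) hu
  -- At the cuts `rank g` and `rank g + 1` the chain elements have empty prescribed parts, so
  -- consecutive ones differ by the flip at the vertex in between.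
  have hflip : ∀ g, ℓ.FlipAt g (s (ℓ.rank g)) (s (ℓ.rank g + 1)) := fun g =>
    ⟨hmem_U g, hmem_D g, fun k hk => iff_of_false (hsD _ k hk.le) (hsD _ k hk),
      fun k hk => iff_of_false (hsU _ k hk) (hsU _ k (hk.trans (Nat.lt_succ_self _)))⟩
  have hlt : ∀ i < Fintype.card V, s i < s (i + 1) := by
    intro i hi
    obtain ⟨g, rfl⟩ := ℓ.exists_rank_eq hi
    exact lt_of_le_of_ne (hflip g).le (hflip g).ne
  have hmono : ∀ {a b : ℕ}, a ≤ b → s a ≤ s b := fun {a b} hab =>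
    IndepPoset.le_of_D_subset a
      (fun k hk => iff_of_false (hsU _ k hk) (hsU _ k (hk.trans_le hab)))
      fun k hk hka => absurd hka (hsD _ k hk)
  let L : Lattice (IndepPoset G ℓ ℓ') :=
    { instPartialOrderIndepPoset G ℓ ℓ' with
      sup := fun x y => (hL x y).1.choose
      inf := fun x y => (hL x y).2.choose
      le_sup_left := fun x y => (hL x y).1.choose_spec.1 (by simp)
      le_sup_right := fun x y => (hL x y).1.choose_spec.1 (by simp)
      sup_le := fun x y z hx hy => (hL x y).1.choose_spec.2 (by
        rintro t (rfl | rfl)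
        · exact hx
        · exact hy)
      inf_le_left := fun x y => (hL x y).2.choose_spec.1 (by simp)
      inf_le_right := fun x y => (hL x y).2.choose_spec.1 (by simp)
      le_inf := fun x y z hx hy => (hL y z).2.choose_spec.2 (by
        rintro t (rfl | rfl)
        · exact hx
        · exact hy) }
  refine ⟨L, rfl, isTrim_of_labelling j m hcov
    { length := Fintype.card V, toFun := fun i => s i, step := fun i => hlt i i.2 } rfl
    fun i g => ?_⟩
  -- The chain flips `g` between `s (rank g)` and `s (rank g + 1)`: later elements lie above `j g`,
  -- earlier ones below `m g`.
  rcases lt_or_ge (ℓ.rank g) (i : ℕ) with h | h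
  · exact Or.inl ((hjx _ g (hmem_D g)).trans (hmono h))
  · exact Or.inr ((hmono h).trans (hxm _ g (hmem_U g)))

end Trim
end IndependencePosets

theorem mainTheorem3 {V : Type*} [Fintype V] [DecidableEq V] (G : Digraph V)
    (hG : IndependencePosets.IsAcyclic G)
    (ℓ : IndependencePosets.LinearExt G) (ℓ' : IndependencePosets.RevLinearExt G)
    (hL : IndependencePosets.IsLatticePoset (IndependencePosets.IndepPoset G ℓ ℓ')) :
    IndependencePosets.IsTrimLatticePoset (IndependencePosets.IndepPoset G ℓ ℓ') :=
  IndependencePosets.IndepPoset.isTrimLatticePoset hL
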